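/- Let $m\ge 0$ and let $J,D,G,P,\Pi\in M_m(\mathbb R)$ with $J=J^T>0$, $D=D^T$, $G=-G^T$, $P=-P^T$, $\Pi=\Pi^T$. Put $$A=J^{-1/2}(D+G)J^{-1/2},\qquad B=J^{-1/2}(P+\Pi)J^{-1/2}.$$ Definitions. $[X,Y]=XY-YX$. For a real matrix $X$ with (complex) Jordan decomposition $X=T\,\mathrm{diag}[\lambda_1E+H,\dots,\lambda_rE+H]\,T^{-1}$ (blocks of possibly different orders, $H$ having ones on the first superdiagonal and zeros elsewhere), let $X_R=T\,\mathrm{diag}[\mathrm{Re}\lambda_1E+H,\dots,\mathrm{Re}\lambda_rE+H]\,T^{-1}$; this matrix is real and depends only on $X$. A matrix function $L\in M_m(C^1[0,\infty))$ is called regular if $\sup_{t\ge0}\|L(t)\|<\infty$ and $|\det L(t)|>\eta$ for some $\eta>0$ and all $t\ge0$. The system $\ddot x+\mathcal A\dot x+\mathcal Bx=0$ is $L$-equivalent to $\ddot\xi+V\dot\xi+W\xi=0$ if there is a regular, twice differentiable $L$ with $$V=L^{-1}(2\dot L+\mathcal AL),\qquad W=L^{-1}(\ddot L+\mathcal A\dot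 L+\mathcal BL)\qquad\text{for all }t\ge0 .$$ The system $J\ddot x+(D+G)\dot x+(P+\Pi)x=0$ is called $L$-equivalent to $\ddot\xi+V\dot\xi+W\xi=0$ if $\ddot x+J^{-1}(D+G)\dot x+J^{-1}(P+\Pi)x=0$ is. Let $V,C\in M_m(\mathbb R)$ with $C$ nonsingular satisfy $$[A,CVC^{-1}]=0,\qquad [B,A-CVC^{-1}]=0,\qquad CV_R=A_RC,$$ and let $W=\tfrac14V^2+C^{-1}\left(B-\tfrac14A^2\right)C$. 1. If $V=V^T$, then $J\ddot x+(D+G)\dot x+(P+\Pi)x=0$ is $L$-equivalent to $\ddot\xi+V\dot\xi+W\xi=0$ (which contains no gyroscopic structures). 2. If $V^2-(V^2)^T+C^{-1}(4B-A^2)C-C^T(4B-A^2)^T(C^{-1})^T=0$, then $J\ddot x+(D+G)\dot x+(P+\Pi)x=0$ is $L$-equivalent to $\ddot\xi+V\dot\xi+W\xi=0$, and $W=W^T$. 3. If $V=V^T$ and $C^{-1}ZC-C^TZ^T(C^{-1})^T=0$, where $Z=B-\tfrac14A^2$, then $J\ddot x+(D+G)\dot x+(P+\Pi)x=0$ is $L$-equivalent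 to $\ddot\xi+V\dot\xi+W\xi=0$, and $V=V^T$, $W=W^T$. In each case the normalized system $\ddot y+A\dot y+By=0$ (where $x=J^{-1/2}y$) is $L$-equivalent to $\ddot\xi+V\dot\xi+W\xi=0$ as well. -/

import Mathlib

open scoped Matrix

/-- The `p × p` Jordan block `μ E + H`, with ones on the first superdiagonal. -/
def jordanBlock (p : ℕ) (μ : ℂ) : Matrix (Fin p) (Fin p) ℂ :=
  fun i j => if i = j then μ else if (i : ℕ) + 1 = j then 1 else 0

/-- The block diagonal matrix `diag[μ₁ E + H, …, μᵣ E + H]`, whose `k`-th block has order `p k`;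
the bijection `e` numbers its rows and columns. -/
def jordanMatrix {m r : ℕ} (p : Fin r → ℕ) (e : (Σ k, Fin (p k)) ≃ Fin m) (μ : Fin r → ℂ) :
    Matrix (Fin m) (Fin m) ℂ :=
  (Matrix.blockDiagonal' fun k => jordanBlock (p k) (μ k)).submatrix e.symm e.symm

/-- A Jordan decomposition `A = T diag[λ₁ E + H, …, λᵣ E + H] T⁻¹` of a real matrix over `ℂ`. -/
structure JordanDecomposition {m : ℕ} (A : Matrix (Fin m) (Fin m) ℝ) where
  r : ℕ
  size : Fin r → ℕ
  eigenvalue : Fin r → ℂ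
  numbering : (Σ k, Fin (size k)) ≃ Fin m
  size_pos : ∀ k, 0 < size k
  T : Matrix (Fin m) (Fin m) ℂ
  isUnit_det : IsUnit T.det
  eq : A.map Complex.ofReal = T * jordanMatrix size numbering eigenvalue * T⁻¹

theorem jordan_quotient_basis (q : Polynomial ℂ) (hq : Irreducible q) (d : ℕ)
    (I : Ideal (Polynomial ℂ)) (hI : I = Ideal.span {q ^ d}) :
    ∃ (μ : ℂ) (b : Module.Basis (Fin d) ℂ (Polynomial ℂ ⧸ I)),
      ∀ j, (Polynomial.X : Polynomial ℂ) • b j = ∑ i, jordanBlock d μ i j • b i := by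
  obtain ⟨μ, hμ⟩ := Polynomial.exists_root_of_degree_eq_one
    (IsAlgClosed.degree_eq_one_of_irreducible ℂ hq)
  have hass : Associated (Polynomial.X - Polynomial.C μ) q :=
    (Polynomial.irreducible_X_sub_C μ).associated_of_dvd hq (Polynomial.dvd_iff_isRoot.2 hμ)
  have hI' : I = Ideal.span {(Polynomial.X - Polynomial.C μ) ^ d} := by
    rw [hI, Ideal.span_singleton_eq_span_singleton]
    exact (hass.pow_pow).symm
  subst hI'
  set I : Ideal (Polynomial ℂ) := Ideal.span {(Polynomial.X - Polynomial.C μ) ^ d} with hIdef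
  have hz : ∀ k, d ≤ k → Ideal.Quotient.mk I ((Polynomial.X - Polynomial.C μ) ^ k) = 0 := by
    intro k hk
    rw [Ideal.Quotient.eq_zero_iff_mem, hIdef, Ideal.mem_span_singleton]
    exact pow_dvd_pow _ hk
  let v : Fin d → Polynomial ℂ ⧸ I :=
    fun j => Ideal.Quotient.mk I ((Polynomial.X - Polynomial.C μ) ^ (d - 1 - j))
  have hsmul : ∀ (c : ℂ) (f : Polynomial ℂ),
      Ideal.Quotient.mk I (Polynomial.C c * f) = c • Ideal.Quotient.mk I f := by
    intro c f
    rw [← Polynomial.smul_eq_C_mul]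
    rfl
  have hspan : ⊤ ≤ Submodule.span ℂ (Set.range v) := by
    rintro x -
    obtain ⟨f, rfl⟩ := Ideal.Quotient.mk_surjective x
    rw [← Polynomial.sum_taylor_eq f μ, Polynomial.sum_def, map_sum]
    refine Submodule.sum_mem _ fun k _ => ?_
    rw [hsmul]
    refine Submodule.smul_mem _ _ ?_
    by_cases hk : d ≤ k
    · rw [hz k hk]
      exact Submodule.zero_mem _
    · refine Submodule.subset_span ⟨⟨d - 1 - k, by omega⟩, ?_⟩
      simp only [v]
      congr 2
      omega
  have hcard : Fintype.card (Fin d) = Module.finrank ℂ (Polynomial ℂ ⧸ I) := by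
    rw [hIdef, finrank_quotient_span_eq_natDegree]
    simp
  refine ⟨μ, basisOfTopLeSpanOfCardEqFinrank v hspan hcard, fun j => ?_⟩
  simp only [coe_basisOfTopLeSpanOfCardEqFinrank]
  have hX : (Polynomial.X : Polynomial ℂ) • v j = μ • v j +
      Ideal.Quotient.mk I ((Polynomial.X - Polynomial.C μ) ^ (d - 1 - j + 1)) := by
    have h1 : (Polynomial.X : Polynomial ℂ) • v j = Ideal.Quotient.mk I
        (Polynomial.X * (Polynomial.X - Polynomial.C μ) ^ (d - 1 - (j : ℕ))) := rfl
    rw [h1]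
    simp only [v]
    rw [← hsmul, ← map_add]
    congr 1
    ring
  have hsum : ∀ i, jordanBlock d μ i j • v i =
      (if i = j then μ • v i else 0) + (if (i : ℕ) + 1 = j then v i else 0) := by
    intro i
    unfold jordanBlock
    by_cases h : i = j
    · subst h
      simp
    · by_cases h' : (i : ℕ) + 1 = j <;> simp [h, h']
  rw [hX, Finset.sum_congr rfl fun i _ => hsum i, Finset.sum_add_distrib]
  congr 1
  · simp
  · rcases Nat.eq_zero_or_pos (j : ℕ) with h | h
    · rw [hz _ (by omega)]
      symm
      refine Finset.sum_eq_zero fun i _ => ?_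
      rw [if_neg (by omega)]
    · rw [Finset.sum_eq_single ⟨(j : ℕ) - 1, by omega⟩]
      · rw [if_pos (by simp; omega)]
        simp only [v]
        congr 2
        have := j.2
        omega
      · intro i _ hi
        rw [if_neg]
        intro h'
        apply hi
        ext
        simp
        omega
      · simp

theorem nonempty_jordanDecomposition {m : ℕ} (A : Matrix (Fin m) (Fin m) ℝ) :
    Nonempty (JordanDecomposition A) := by
  classical
  let f : Module.End ℂ (Fin m → ℂ) := Matrix.toLin' (A.map Complex.ofReal)
  obtain ⟨ι, _, q, hq, d, ⟨L0⟩⟩ := Module.equiv_directSum_of_isTorsion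
    (Module.AEval.isTorsion_of_finiteDimensional ℂ (Fin m → ℂ) f)
  choose μ b hb using fun i => jordan_quotient_basis (q i) (hq i) (d i) _ rfl
  let L : (Fin m → ℂ) ≃ₗ[ℂ] (DirectSum ι fun i => Polynomial ℂ ⧸ Ideal.span {q i ^ d i}) :=
    (Module.AEval'.of f).trans (L0.restrictScalars ℂ)
  have hL : ∀ x, L (f x) = (Polynomial.X : Polynomial ℂ) • L x := by
    intro x
    change L0 (Module.AEval'.of f (f x)) = _ • L0 (Module.AEval'.of f x)
    rw [← Module.AEval'.X_smul_of, map_smul]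
  let B0 : Module.Basis (Σ i, Fin (d i)) ℂ (Fin m → ℂ) :=
    Module.Basis.map (DFinsupp.basis b) L.symm
  have hB0 : ∀ i j, L (B0 ⟨i, j⟩) = DirectSum.lof ℂ ι _ i (b i j) := by
    intro i j
    simp only [B0, Module.Basis.map_apply, LinearEquiv.apply_symm_apply]
    apply (DFinsupp.basis b).repr.injective
    rw [Module.Basis.repr_self]
    change _ = (sigmaFinsuppLequivDFinsupp ℂ).symm
      (DFinsupp.mapRange.linearEquiv (fun i => (b i).repr) (DFinsupp.single i (b i j)))
    rw [LinearEquiv.eq_symm_apply, DFinsupp.mapRange.linearEquiv_apply, DFinsupp.mapRange_single]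
    simp
  have hfB0 : ∀ i j, f (B0 ⟨i, j⟩) = ∑ k, jordanBlock (d i) (μ i) k j • B0 ⟨i, k⟩ := by
    intro i j
    apply L.injective
    rw [hL, hB0, map_sum]
    simp only [map_smul, hB0]
    have h1 : (Polynomial.X : Polynomial ℂ) • DirectSum.lof ℂ ι
        (fun i => Polynomial ℂ ⧸ Ideal.span {q i ^ d i}) i (b i j) =
        DirectSum.lof ℂ ι _ i ((Polynomial.X : Polynomial ℂ) • b i j) :=
      (map_smul (DirectSum.lof (Polynomial ℂ) ι
        (fun i => Polynomial ℂ ⧸ Ideal.span {q i ^ d i}) i) Polynomial.X (b i j)).symm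
    rw [h1, hb, map_sum]
    simp only [map_smul]
  let ε := (Fintype.equivFin {i : ι // 0 < d i}).symm
  let g : (Σ k, Fin (d (ε k))) → (Σ i, Fin (d i)) := fun x => ⟨ε x.1, x.2⟩
  have hg : Function.Bijective g := by
    constructor
    · rintro ⟨k, j⟩ ⟨k', j'⟩ h
      simp only [g, Sigma.mk.injEq] at h
      obtain ⟨h1, h2⟩ := h
      have h3 : k = k' := ε.injective (Subtype.ext h1)
      subst h3
      simpa using h2
    · rintro ⟨i, j⟩
      obtain ⟨k, hk⟩ := ε.surjective ⟨i, j.pos⟩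
      have hk' : (ε k : ι) = i := by rw [hk]
      subst hk'
      exact ⟨⟨k, j⟩, rfl⟩
  let B : Module.Basis (Σ k, Fin (d (ε k))) ℂ (Fin m → ℂ) :=
    B0.reindex (Equiv.ofBijective g hg).symm
  have hB : ∀ k j, B ⟨k, j⟩ = B0 ⟨ε k, j⟩ := by
    intro k j
    simp [B, g]
  let e : (Σ k, Fin (d (ε k))) ≃ Fin m := B.indexEquiv (Pi.basisFun ℂ (Fin m))
  let T : Matrix (Fin m) (Fin m) ℂ := (Pi.basisFun ℂ (Fin m)).toMatrix (B.reindex e)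
  have hT : IsUnit T.det := by
    rw [← Matrix.isUnit_iff_isUnit_det]
    exact @isUnit_of_invertible _ _ _
      (Module.Basis.invertibleToMatrix (Pi.basisFun ℂ (Fin m)) (B.reindex e))
  have hTe : ∀ i x, T i (e x) = B x i := by
    intro i x
    simp [T, Module.Basis.toMatrix_apply]
  refine ⟨⟨_, fun k => d (ε k), fun k => μ (ε k), e, fun k => (ε k).2, T, hT, ?_⟩⟩
  have hAT : A.map Complex.ofReal * T =
      T * jordanMatrix (fun k => d (ε k)) e (fun k => μ (ε k)) := by
    ext i c
    obtain ⟨⟨k, j⟩, rfl⟩ := e.surjective c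
    have h1 : (A.map Complex.ofReal * T) i (e ⟨k, j⟩) = f (B ⟨k, j⟩) i := by
      simp only [f, Matrix.mul_apply, hTe, Matrix.toLin'_apply, Matrix.mulVec, dotProduct]
    rw [h1, hB, hfB0, Matrix.mul_apply, ← e.sum_comp, Fintype.sum_sigma,
      Finset.sum_eq_single k]
    · simp only [hTe, jordanMatrix, Matrix.submatrix_apply, Equiv.symm_apply_apply,
        Matrix.blockDiagonal'_apply_eq, hB, Finset.sum_apply, Pi.smul_apply, smul_eq_mul]
      exact Finset.sum_congr rfl fun _ _ => mul_comm _ _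
    · intro k' _ hk'
      refine Finset.sum_eq_zero fun j' _ => ?_
      simp only [jordanMatrix, Matrix.submatrix_apply, Equiv.symm_apply_apply]
      rw [Matrix.blockDiagonal'_apply_ne _ _ _ hk', mul_zero]
    · simp
  rw [← hAT, Matrix.mul_nonsing_inv_cancel_right _ _ hT]

/-- The matrix `A_R = T diag[Re λ₁ E + H, …, Re λᵣ E + H] T⁻¹` obtained from a Jordan decomposition
`A = T diag[λ₁ E + H, …, λᵣ E + H] T⁻¹`. (It depends only on `A`, and its entries are real.) -/
noncomputable def jordanRealPart {m : ℕ} (A : Matrix (Fin m) (Fin m) ℝ) :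
    Matrix (Fin m) (Fin m) ℂ :=
  let Δ := Classical.choice (nonempty_jordanDecomposition A)
  Δ.T * jordanMatrix Δ.size Δ.numbering (fun k => ((Δ.eigenvalue k).re : ℂ)) * Δ.T⁻¹

/-- `J^{-1/2}`: the inverse of the positive semidefinite square root (via the functional calculus
of symmetric matrices). -/
noncomputable def invSqrt {m : ℕ} (J : Matrix (Fin m) (Fin m) ℝ) : Matrix (Fin m) (Fin m) ℝ :=
  (cfc Real.sqrt J)⁻¹

/-- `L` is regular on `[0, +∞)`: continuously differentiable, bounded, and with determinant bounded
away from zero. -/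
structure IsRegularMatrix {m : ℕ} (L : ℝ → Matrix (Fin m) (Fin m) ℝ) : Prop where
  contDiffOn : ∀ i j, ContDiffOn ℝ 1 (fun t => L t i j) (Set.Ici 0)
  det_gt : ∃ η > 0, ∀ t ≥ 0, η < |(L t).det|
  bounded : ∃ M, ∀ t ≥ 0, ∀ i j, |L t i j| ≤ M

/-- `x'' + A x' + B x = 0` is `L`-equivalent to `ξ'' + V ξ' + W ξ = 0`: there is a twice
differentiable regular matrix `L` on `[0, +∞)`, with derivatives `L₁ = L'` and `L₂ = L''` (one-sided
at `0`), such that the substitution `x = L ξ` turns the first system into the second. -/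
def LEquivalent {m : ℕ} (A B V W : Matrix (Fin m) (Fin m) ℝ) : Prop :=
  ∃ L L₁ L₂ : ℝ → Matrix (Fin m) (Fin m) ℝ, IsRegularMatrix L ∧
    (∀ t ≥ 0, ∀ i j, HasDerivWithinAt (fun s => L s i j) (L₁ t i j) (Set.Ici 0) t) ∧
    (∀ t ≥ 0, ∀ i j, HasDerivWithinAt (fun s => L₁ s i j) (L₂ t i j) (Set.Ici 0) t) ∧
    ∀ t ≥ 0, V = (L t)⁻¹ * ((2 : ℝ) • L₁ t + A * L t) ∧
      W = (L t)⁻¹ * (L₂ t + A * L₁ t + B * L t)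

/-- `J x'' + K x' + S x = 0` (with `J` nonsingular) is `L`-equivalent to `ξ'' + V ξ' + W ξ = 0`:
the same system with the leading coefficient divided out is. -/
def LEquivalentOfInertia {m : ℕ} (J K S V W : Matrix (Fin m) (Fin m) ℝ) : Prop :=
  LEquivalent (J⁻¹ * K) (J⁻¹ * S) V W

theorem commute_diagonal_of_commute_jordanMatrix {m r : ℕ} (p : Fin r → ℕ)
    (e : (Σ k, Fin (p k)) ≃ Fin m) (μ : Fin r → ℂ) (f : ℂ → ℂ) (X : Matrix (Fin m) (Fin m) ℂ)
    (h : Commute X (jordanMatrix p e μ)) :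
    Commute X (Matrix.diagonal fun i => f (μ (e.symm i).1)) := by
  have hrow : ∀ (k : Fin r) (i : Fin (p k)) (c : Fin m), (jordanMatrix p e μ * X) (e ⟨k, i⟩) c =
      μ k * X (e ⟨k, i⟩) c +
        if hi : (i : ℕ) + 1 < p k then X (e ⟨k, ⟨i + 1, hi⟩⟩) c else 0 := by
    intro k i c
    rw [Matrix.mul_apply, ← e.sum_comp, Fintype.sum_sigma, Finset.sum_eq_single k]
    · simp only [jordanMatrix, Matrix.submatrix_apply, Equiv.symm_apply_apply,
        Matrix.blockDiagonal'_apply_eq]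
      have hs : ∀ j : Fin (p k), jordanBlock (p k) (μ k) i j * X (e ⟨k, j⟩) c =
          (if i = j then μ k * X (e ⟨k, j⟩) c else 0) +
            (if (i : ℕ) + 1 = j then X (e ⟨k, j⟩) c else 0) := by
        intro j
        unfold jordanBlock
        by_cases h : i = j
        · subst h
          simp
        · by_cases h' : (i : ℕ) + 1 = j <;> simp [h, h']
      rw [Finset.sum_congr rfl fun j _ => hs j, Finset.sum_add_distrib]
      congr 1
      · simp
      · split_ifs with hi
        · rw [Finset.sum_eq_single ⟨i + 1, hi⟩]
          · simp
          · intro j _ hj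
            rw [if_neg]
            intro h'
            exact hj (Fin.ext h'.symm)
          · simp
        · refine Finset.sum_eq_zero fun j _ => if_neg ?_
          have := j.2
          omega
    · intro k' _ hk'
      refine Finset.sum_eq_zero fun j' _ => ?_
      simp only [jordanMatrix, Matrix.submatrix_apply, Equiv.symm_apply_apply]
      rw [Matrix.blockDiagonal'_apply_ne _ _ _ hk'.symm, zero_mul]
    · simp
  have hcol : ∀ (k : Fin r) (j : Fin (p k)) (c : Fin m), (X * jordanMatrix p e μ) c (e ⟨k, j⟩) =
      μ k * X c (e ⟨k, j⟩) +
        if 0 < (j : ℕ) then X c (e ⟨k, ⟨j - 1, by omega⟩⟩) else 0 := by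
    intro k j c
    rw [Matrix.mul_apply, ← e.sum_comp, Fintype.sum_sigma, Finset.sum_eq_single k]
    · simp only [jordanMatrix, Matrix.submatrix_apply, Equiv.symm_apply_apply,
        Matrix.blockDiagonal'_apply_eq]
      have hs : ∀ i : Fin (p k), X c (e ⟨k, i⟩) * jordanBlock (p k) (μ k) i j =
          (if i = j then μ k * X c (e ⟨k, i⟩) else 0) +
            (if (i : ℕ) + 1 = j then X c (e ⟨k, i⟩) else 0) := by
        intro i
        unfold jordanBlock
        by_cases h : i = j
        · subst h
          simp [mul_comm]
        · by_cases h' : (i : ℕ) + 1 = j <;> simp [h, h']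
      rw [Finset.sum_congr rfl fun j _ => hs j, Finset.sum_add_distrib]
      congr 1
      · simp
      · split_ifs with hj
        · rw [Finset.sum_eq_single ⟨j - 1, by omega⟩]
          · rw [if_pos]
            simp only
            omega
          · intro i _ hi
            rw [if_neg]
            intro h'
            apply hi
            ext
            simp only
            omega
          · simp
        · exact Finset.sum_eq_zero fun i _ => if_neg (by omega)
    · intro k' _ hk'
      refine Finset.sum_eq_zero fun j' _ => ?_
      simp only [jordanMatrix, Matrix.submatrix_apply, Equiv.symm_apply_apply]
      rw [Matrix.blockDiagonal'_apply_ne _ _ _ hk', mul_zero]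
    · simp
  have hzero : ∀ (k l : Fin r), μ k ≠ μ l → ∀ (n : ℕ) (i : Fin (p k)) (j : Fin (p l)),
      p k - i + j ≤ n → X (e ⟨k, i⟩) (e ⟨l, j⟩) = 0 := by
    intro k l hkl n
    induction n with
    | zero =>
      intro i j hij
      omega
    | succ n ih =>
      intro i j hij
      have h1 := congrFun (congrFun h.eq (e ⟨k, i⟩)) (e ⟨l, j⟩)
      rw [hrow, hcol] at h1
      have h2 : (if hi : (i : ℕ) + 1 < p k then X (e ⟨k, ⟨i + 1, hi⟩⟩) (e ⟨l, j⟩) else 0) = 0 := by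
        split_ifs with hi
        · exact ih _ _ (by simp only; omega)
        · rfl
      have h3 : (if 0 < (j : ℕ) then X (e ⟨k, i⟩) (e ⟨l, ⟨j - 1, by omega⟩⟩) else 0) = 0 := by
        split_ifs with hj
        · exact ih _ _ (by simp only; omega)
        · rfl
      rw [h2, h3, add_zero, add_zero] at h1
      exact (mul_eq_mul_right_iff.1 h1).resolve_left (Ne.symm hkl)
  ext a b
  obtain ⟨⟨k, i⟩, rfl⟩ := e.surjective a
  obtain ⟨⟨l, j⟩, rfl⟩ := e.surjective b
  simp only [Matrix.mul_diagonal, Matrix.diagonal_mul, Equiv.symm_apply_apply]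
  by_cases hkl : μ k = μ l
  · rw [hkl, mul_comm]
  · rw [hzero k l hkl _ i j le_rfl, zero_mul, mul_zero]

theorem jordanMatrix_sub_re {m r : ℕ} (p : Fin r → ℕ) (e : (Σ k, Fin (p k)) ≃ Fin m)
    (μ : Fin r → ℂ) :
    jordanMatrix p e μ - jordanMatrix p e (fun k => ((μ k).re : ℂ)) =
      Matrix.diagonal fun i => ((μ (e.symm i).1).im : ℂ) * Complex.I := by
  ext a b
  obtain ⟨⟨k, i⟩, rfl⟩ := e.surjective a
  obtain ⟨⟨l, j⟩, rfl⟩ := e.surjective b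
  simp only [jordanMatrix, Matrix.sub_apply, Matrix.submatrix_apply, Equiv.symm_apply_apply,
    Matrix.diagonal_apply, e.injective.eq_iff]
  by_cases hkl : k = l
  · subst hkl
    by_cases hij : i = j
    · subst hij
      simp only [Matrix.blockDiagonal'_apply_eq, jordanBlock, if_true]
      nth_rewrite 1 [← Complex.re_add_im (μ k)]
      ring
    · simp [Matrix.blockDiagonal'_apply_eq, jordanBlock, hij]
  · rw [Matrix.blockDiagonal'_apply_ne _ _ _ hkl, Matrix.blockDiagonal'_apply_ne _ _ _ hkl,
      if_neg (by rintro ⟨⟩; exact hkl rfl), sub_zero]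

/-- The difference `A - A_R` is diagonalizable with imaginary eigenvalues and commutes with
everything that commutes with `A`. -/
theorem exists_sub_jordanRealPart {m : ℕ} (A : Matrix (Fin m) (Fin m) ℝ) :
    ∃ (T : Matrix (Fin m) (Fin m) ℂ) (d : Fin m → ℝ), IsUnit T ∧
      A.map Complex.ofReal - jordanRealPart A =
        T * Matrix.diagonal (fun i => (d i : ℂ) * Complex.I) * T⁻¹ ∧
      ∀ X, Commute X (A.map Complex.ofReal) →
        Commute X (A.map Complex.ofReal - jordanRealPart A) := by
  set Δ := Classical.choice (nonempty_jordanDecomposition A) with hΔ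
  have hT : IsUnit Δ.T := (Matrix.isUnit_iff_isUnit_det _).2 Δ.isUnit_det
  have hTT : Δ.T⁻¹ * Δ.T = 1 := Matrix.nonsing_inv_mul _ Δ.isUnit_det
  have hTT' : Δ.T * Δ.T⁻¹ = 1 := Matrix.mul_nonsing_inv _ Δ.isUnit_det
  have hsub : A.map Complex.ofReal - jordanRealPart A = Δ.T * Matrix.diagonal
      (fun i => ((Δ.eigenvalue (Δ.numbering.symm i).1).im : ℂ) * Complex.I) * Δ.T⁻¹ := by
    rw [← jordanMatrix_sub_re Δ.size Δ.numbering Δ.eigenvalue, mul_sub, sub_mul, ← Δ.eq]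
    rfl
  refine ⟨Δ.T, _, hT, hsub, fun X hX => ?_⟩
  have hconj : ∀ Y Z : Matrix (Fin m) (Fin m) ℂ, Commute Y (Δ.T * Z * Δ.T⁻¹) ↔
      Commute (Δ.T⁻¹ * Y * Δ.T) Z := by
    intro Y Z
    constructor
    · intro h
      calc Δ.T⁻¹ * Y * Δ.T * Z = Δ.T⁻¹ * (Y * (Δ.T * Z * Δ.T⁻¹)) * Δ.T := by
            simp only [mul_assoc, hTT, mul_one]
        _ = (Δ.T⁻¹ * Δ.T) * Z * Δ.T⁻¹ * Y * Δ.T := by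
            rw [h.eq]
            simp only [mul_assoc]
        _ = Z * (Δ.T⁻¹ * Y * Δ.T) := by
            rw [hTT]
            simp only [mul_assoc, one_mul]
    · intro h
      calc Y * (Δ.T * Z * Δ.T⁻¹) = (Δ.T * Δ.T⁻¹) * (Y * (Δ.T * Z * Δ.T⁻¹)) := by
            rw [hTT', one_mul]
        _ = Δ.T * (Δ.T⁻¹ * Y * Δ.T * Z) * Δ.T⁻¹ := by simp only [mul_assoc]
        _ = Δ.T * Z * Δ.T⁻¹ * Y * (Δ.T * Δ.T⁻¹) := by
            rw [h.eq]
            simp only [mul_assoc]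
        _ = Δ.T * Z * Δ.T⁻¹ * Y := by rw [hTT', mul_one]
  rw [Δ.eq, hconj] at hX
  rw [hsub, hconj]
  exact commute_diagonal_of_commute_jordanMatrix _ _ _ (fun z => (z.im : ℂ) * Complex.I) _ hX
section
open scoped Matrix.Norms.Operator

attribute [-instance] Matrix.SpecialLinearGroup.hasCoeToGeneralLinearGroup in
theorem exp_smul_conj_diagonal_imaginary {m : ℕ} (T : Matrix (Fin m) (Fin m) ℂ) (d : Fin m → ℝ)
    (hT : IsUnit T) (s : ℝ) :
    NormedSpace.exp (s • (T * Matrix.diagonal (fun i => (d i : ℂ) * Complex.I) * T⁻¹)) =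
      T * Matrix.diagonal (fun i => Complex.exp ((s * d i : ℝ) * Complex.I)) * T⁻¹ := by
  have h : s • (T * Matrix.diagonal (fun i => (d i : ℂ) * Complex.I) * T⁻¹) =
      T * Matrix.diagonal (fun i => ((s * d i : ℝ) : ℂ) * Complex.I) * T⁻¹ := by
    rw [← smul_mul_assoc, ← mul_smul_comm, ← Matrix.diagonal_smul]
    congr 3
    ext i
    simp [mul_assoc]
  rw [h, Matrix.exp_conj _ _ hT, Matrix.exp_diagonal]
  congr 3
  ext i
  rw [Pi.coe_exp, Complex.exp_eq_exp_ℂ]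

theorem exp_smul_conj_diagonal_imaginary_norm_le {m : ℕ} (T : Matrix (Fin m) (Fin m) ℂ)
    (d : Fin m → ℝ) (hT : IsUnit T) (s : ℝ) :
    ‖NormedSpace.exp (s • (T * Matrix.diagonal (fun i => (d i : ℂ) * Complex.I) * T⁻¹))‖ ≤
      ‖T‖ * ‖T⁻¹‖ := by
  rw [exp_smul_conj_diagonal_imaginary T d hT]
  refine (norm_mul_le _ _).trans (mul_le_mul_of_nonneg_right ?_ (norm_nonneg _))
  refine (norm_mul_le _ _).trans (mul_le_of_le_one_right (norm_nonneg _) ?_)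
  rw [Matrix.linfty_opNorm_diagonal, pi_norm_le_iff_of_nonneg zero_le_one]
  intro i
  rw [Complex.norm_exp_ofReal_mul_I]

theorem norm_det_exp_smul_conj_diagonal_imaginary {m : ℕ} (T : Matrix (Fin m) (Fin m) ℂ)
    (d : Fin m → ℝ) (hT : IsUnit T) (s : ℝ) :
    ‖(NormedSpace.exp
      (s • (T * Matrix.diagonal (fun i => (d i : ℂ) * Complex.I) * T⁻¹))).det‖ = 1 := by
  rw [exp_smul_conj_diagonal_imaginary T d hT, Matrix.det_conj hT, Matrix.det_diagonal,
    norm_prod]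
  exact Finset.prod_eq_one fun i _ => Complex.norm_exp_ofReal_mul_I _

theorem map_ofReal_exp {m : ℕ} (K : Matrix (Fin m) (Fin m) ℝ) :
    (NormedSpace.exp K).map Complex.ofReal = NormedSpace.exp (K.map Complex.ofReal) :=
  NormedSpace.map_exp (Complex.ofRealHom.mapMatrix (m := Fin m))
    (continuous_id.matrix_map Complex.continuous_ofReal) K

theorem hasDerivAt_exp_smul_mul_apply {m : ℕ} (K C : Matrix (Fin m) (Fin m) ℝ) (t : ℝ)
    (i j : Fin m) :
    HasDerivAt (fun s : ℝ => (NormedSpace.exp (s • K) * C) i j)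
      ((K * (NormedSpace.exp (t • K) * C)) i j) t := by
  have h := (hasDerivAt_exp_smul_const' (𝕂 := ℝ) K t).mul_const C
  rw [mul_assoc] at h
  exact (Matrix.entryLinearMap ℝ ℝ i j).toContinuousLinearMap.hasFDerivAt.comp_hasDerivAt t h

theorem isRegularMatrix_exp_smul_mul {m : ℕ} (K C : Matrix (Fin m) (Fin m) ℝ) (hC : C.det ≠ 0)
    (T₁ T₂ : Matrix (Fin m) (Fin m) ℂ) (d₁ d₂ : Fin m → ℝ) (hT₁ : IsUnit T₁) (hT₂ : IsUnit T₂)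
    (hcomm : Commute (T₁ * Matrix.diagonal (fun i => (d₁ i : ℂ) * Complex.I) * T₁⁻¹)
      (T₂ * Matrix.diagonal (fun i => (d₂ i : ℂ) * Complex.I) * T₂⁻¹)) (c : ℝ)
    (hK : K.map Complex.ofReal =
      c • (T₁ * Matrix.diagonal (fun i => (d₁ i : ℂ) * Complex.I) * T₁⁻¹ -
        T₂ * Matrix.diagonal (fun i => (d₂ i : ℂ) * Complex.I) * T₂⁻¹)) :
    IsRegularMatrix fun t => NormedSpace.exp (t • K) * C := by
  set N₁ := T₁ * Matrix.diagonal (fun i => (d₁ i : ℂ) * Complex.I) * T₁⁻¹ with hN₁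
  set N₂ := T₂ * Matrix.diagonal (fun i => (d₂ i : ℂ) * Complex.I) * T₂⁻¹ with hN₂
  have hexp : ∀ t : ℝ, (NormedSpace.exp (t • K)).map Complex.ofReal =
      NormedSpace.exp ((t * c) • N₁) * NormedSpace.exp ((-(t * c)) • N₂) := by
    intro t
    have h1 : (t • K).map Complex.ofReal = (t * c) • N₁ + (-(t * c)) • N₂ := by
      have h2 : (t • K).map Complex.ofReal = t • K.map Complex.ofReal := by
        ext i j
        simp
      rw [h2, hK, smul_smul, smul_sub, neg_smul, sub_eq_add_neg]
    rw [map_ofReal_exp, h1]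
    exact Matrix.exp_add_of_commute _ _ ((hcomm.smul_left _).smul_right _)
  have hdet : ∀ t : ℝ, |(NormedSpace.exp (t • K) * C).det| = |C.det| := by
    intro t
    have h1 : ((NormedSpace.exp (t • K)).det : ℂ) =
        ((NormedSpace.exp (t • K)).map Complex.ofReal).det :=
      RingHom.map_det Complex.ofRealHom _
    have h2 : |(NormedSpace.exp (t • K)).det| = 1 := by
      rw [← Real.norm_eq_abs, ← Complex.norm_real, h1, hexp, Matrix.det_mul, norm_mul,
        norm_det_exp_smul_conj_diagonal_imaginary _ _ hT₁,
        norm_det_exp_smul_conj_diagonal_imaginary _ _ hT₂, one_mul]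
    rw [Matrix.det_mul, abs_mul, h2, one_mul]
  have hderiv := hasDerivAt_exp_smul_mul_apply K C
  have hbound : ∀ t : ℝ, ‖(NormedSpace.exp (t • K) * C).map Complex.ofReal‖ ≤
      ‖T₁‖ * ‖T₁⁻¹‖ * (‖T₂‖ * ‖T₂⁻¹‖) * ‖C.map Complex.ofReal‖ := by
    intro t
    have h1 : (NormedSpace.exp (t • K) * C).map Complex.ofReal =
        (NormedSpace.exp (t • K)).map Complex.ofReal * C.map Complex.ofReal :=
      Matrix.map_mul (f := Complex.ofRealHom)
    rw [h1, hexp]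
    refine (norm_mul_le _ _).trans (mul_le_mul_of_nonneg_right ?_ (norm_nonneg _))
    refine (norm_mul_le _ _).trans ?_
    exact mul_le_mul (exp_smul_conj_diagonal_imaginary_norm_le _ _ hT₁ _)
      (exp_smul_conj_diagonal_imaginary_norm_le _ _ hT₂ _) (norm_nonneg _) (by positivity)
  have hentry : ∀ (M : Matrix (Fin m) (Fin m) ℝ) (i j : Fin m),
      |M i j| ≤ ‖M.map Complex.ofReal‖ := by
    intro M i j
    rw [← Real.norm_eq_abs, ← Complex.norm_real, Matrix.linfty_opNorm_def]
    refine le_trans ?_ (NNReal.coe_le_coe.2 (Finset.le_sup (Finset.mem_univ i)))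
    rw [NNReal.coe_sum]
    exact Finset.single_le_sum (f := fun j => ‖((M i j : ℝ) : ℂ)‖) (fun _ _ => norm_nonneg _)
      (Finset.mem_univ j)
  refine ⟨fun i j => ?_, ⟨|C.det| / 2, by positivity, fun t _ => ?_⟩,
    ⟨_, fun t _ i j => (hentry _ i j).trans (hbound t)⟩⟩
  · refine ContDiff.contDiffOn (contDiff_one_iff_deriv.2
      ⟨fun t => (hderiv t i j).differentiableAt, ?_⟩)
    have h1 : deriv (fun t : ℝ => (NormedSpace.exp (t • K) * C) i j) =
        fun t => ∑ k, K i k * (NormedSpace.exp (t • K) * C) k j :=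
      funext fun t => (hderiv t i j).deriv.trans Matrix.mul_apply
    rw [h1]
    exact continuous_finsetSum _ fun k _ =>
      continuous_const.mul (continuous_iff_continuousAt.2 fun t => (hderiv t k j).continuousAt)
  · rw [hdet]
    have := abs_pos.2 hC
    linarith

end

theorem lEquivalent_of_commute {m : ℕ} (A B V C : Matrix (Fin m) (Fin m) ℝ) (hC : C.det ≠ 0)
    (hAV : Commute A (C * V * C⁻¹)) (hBV : Commute B (A - C * V * C⁻¹))
    (hR : C.map Complex.ofReal * jordanRealPart V = jordanRealPart A * C.map Complex.ofReal) :
    LEquivalent A B V ((1 / 4 : ℝ) • V ^ 2 + C⁻¹ * (B - (1 / 4 : ℝ) • A ^ 2) * C) := by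
  have hCu : IsUnit C.det := hC.isUnit
  have hCC : C⁻¹ * C = 1 := Matrix.nonsing_inv_mul _ hCu
  have hCC' : C * C⁻¹ = 1 := Matrix.mul_nonsing_inv _ hCu
  set U := C * V * C⁻¹ with hU
  have hUV : C⁻¹ * U * C = V := by
    rw [hU, mul_assoc, mul_assoc, hCC, mul_one, ← mul_assoc, hCC, one_mul]
  have hUV2 : C⁻¹ * U ^ 2 * C = V ^ 2 := by
    calc C⁻¹ * U ^ 2 * C = C⁻¹ * U * (C * C⁻¹) * U * C := by
          rw [hCC', mul_one, pow_two]
          simp only [mul_assoc]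
      _ = (C⁻¹ * U * C) * (C⁻¹ * U * C) := by simp only [mul_assoc]
      _ = V ^ 2 := by rw [hUV, pow_two]
  set K : Matrix (Fin m) (Fin m) ℝ := (-(1 / 2) : ℝ) • (A - U) with hK
  obtain ⟨T₁, d₁, hT₁, hA, hAc⟩ := exists_sub_jordanRealPart A
  obtain ⟨T₂, d₂, hT₂, hV, hVc⟩ := exists_sub_jordanRealPart V
  set Cc := C.map Complex.ofReal with hCc
  have hCi : (C⁻¹).map Complex.ofReal = Cc⁻¹ := by
    refine (Matrix.inv_eq_left_inv ?_).symm
    have h1 : (C⁻¹ * C).map Complex.ofReal = (C⁻¹).map Complex.ofReal * Cc :=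
      Matrix.map_mul (f := Complex.ofRealHom)
    rw [← h1, hCC]
    exact Matrix.map_one _ Complex.ofReal_zero Complex.ofReal_one
  have hCcu : IsUnit Cc.det := by
    have h1 : ((C.det : ℝ) : ℂ) = Cc.det := RingHom.map_det Complex.ofRealHom _
    rw [← h1]
    exact (Complex.ofReal_ne_zero.2 hC).isUnit
  have hCcC : Cc⁻¹ * Cc = 1 := Matrix.nonsing_inv_mul _ hCcu
  have hCcC' : Cc * Cc⁻¹ = 1 := Matrix.mul_nonsing_inv _ hCcu
  have hUmap : U.map Complex.ofReal = Cc * V.map Complex.ofReal * Cc⁻¹ := by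
    rw [← hCi, hU]
    have h1 : (C * V * C⁻¹).map Complex.ofReal =
        (C * V).map Complex.ofReal * (C⁻¹).map Complex.ofReal :=
      Matrix.map_mul (f := Complex.ofRealHom)
    have h2 : (C * V).map Complex.ofReal = Cc * V.map Complex.ofReal :=
      Matrix.map_mul (f := Complex.ofRealHom)
    rw [h1, h2]
  have hUR : U.map Complex.ofReal - jordanRealPart A =
      Cc * (V.map Complex.ofReal - jordanRealPart V) * Cc⁻¹ := by
    rw [mul_sub, sub_mul, hR, mul_assoc (jordanRealPart A), hCcC', mul_one, hUmap]
  have hUT : U.map Complex.ofReal - jordanRealPart A =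
      (Cc * T₂) * Matrix.diagonal (fun i => (d₂ i : ℂ) * Complex.I) * (Cc * T₂)⁻¹ := by
    rw [hUR, hV, Matrix.mul_inv_rev]
    simp only [mul_assoc]
  have hAU : Commute (A.map Complex.ofReal) (U.map Complex.ofReal) :=
    hAV.map (Complex.ofRealHom.mapMatrix (m := Fin m))
  have hUc : ∀ X, Commute X (U.map Complex.ofReal) →
      Commute X (U.map Complex.ofReal - jordanRealPart A) := by
    intro X hX
    have hconj : ∀ Z, Commute (Cc⁻¹ * X * Cc) Z ↔ Commute X (Cc * Z * Cc⁻¹) := by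
      intro Z
      constructor
      · intro h
        have h1 := congrArg (fun Y => Cc * Y * Cc⁻¹) h.eq
        have h2 : Cc * (Cc⁻¹ * X * Cc * Z) * Cc⁻¹ = (Cc * Cc⁻¹) * X * (Cc * Z * Cc⁻¹) := by
          simp only [mul_assoc]
        have h3 : Cc * (Z * (Cc⁻¹ * X * Cc)) * Cc⁻¹ = Cc * Z * Cc⁻¹ * X * (Cc * Cc⁻¹) := by
          simp only [mul_assoc]
        simp only [h2, h3, hCcC', one_mul, mul_one] at h1
        exact h1
      · intro h
        have h1 := congrArg (fun Y => Cc⁻¹ * Y * Cc) h.eq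
        have h2 : Cc⁻¹ * (X * (Cc * Z * Cc⁻¹)) * Cc = Cc⁻¹ * X * Cc * Z * (Cc⁻¹ * Cc) := by
          simp only [mul_assoc]
        have h3 : Cc⁻¹ * (Cc * Z * Cc⁻¹ * X) * Cc = (Cc⁻¹ * Cc) * (Z * (Cc⁻¹ * X * Cc)) := by
          simp only [mul_assoc]
        simp only [h2, h3, hCcC, one_mul, mul_one] at h1
        exact h1
    rw [hUR, ← hconj]
    rw [hUmap, ← hconj] at hX
    exact hVc _ hX
  have hreg : IsRegularMatrix fun t => NormedSpace.exp (t • K) * C := by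
    refine isRegularMatrix_exp_smul_mul K C hC T₁ (Cc * T₂) d₁ d₂ hT₁
      (((Matrix.isUnit_iff_isUnit_det _).2 hCcu).mul hT₂) ?_ (-(1 / 2)) ?_
    · rw [← hA, ← hUT]
      exact (hAc _ (hUc _ hAU).symm).symm
    · rw [← hA, ← hUT, sub_sub_sub_cancel_right]
      ext i j
      simp [hK]
  refine ⟨fun t => NormedSpace.exp (t • K) * C, fun t => K * (NormedSpace.exp (t • K) * C),
    fun t => K * (K * (NormedSpace.exp (t • K) * C)), hreg, fun t _ i j =>
    (hasDerivAt_exp_smul_mul_apply K C t i j).hasDerivWithinAt, fun t _ i j => ?_, fun t _ => ?_⟩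
  · simp only [Matrix.mul_apply (M := K)]
    exact (HasDerivAt.fun_sum fun k _ =>
      (hasDerivAt_exp_smul_mul_apply K C t k j).const_mul (K i k)).hasDerivWithinAt
  · set E := NormedSpace.exp (t • K) with hE
    have hEu : E⁻¹ * E = 1 := Matrix.nonsing_inv_mul _
      ((Matrix.isUnit_iff_isUnit_det _).1 (Matrix.isUnit_exp _))
    have hinv : ∀ X, Commute X (A - U) → (E * C)⁻¹ * (X * (E * C)) = C⁻¹ * X * C := by
      intro X hX
      have hXE : Commute X E := by
        open scoped Matrix.Norms.Operator in
        exact ((hX.smul_right _).smul_right _).exp_right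
      rw [Matrix.mul_inv_rev, ← mul_assoc X, hXE.eq]
      calc C⁻¹ * E⁻¹ * (E * X * C) = C⁻¹ * (E⁻¹ * E) * X * C := by simp only [mul_assoc]
        _ = C⁻¹ * X * C := by rw [hEu, mul_one]
    have hUA : Commute U (A - U) := hAV.symm.sub_right (Commute.refl U)
    have hAA : Commute A (A - U) := (Commute.refl A).sub_right hAV
    constructor
    · have h1 : (2 : ℝ) • (K * (E * C)) + A * (E * C) = U * (E * C) := by
        rw [← smul_mul_assoc, ← add_mul, hK, smul_smul]
        norm_num
      rw [h1, hinv _ hUA, hUV]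
    · have h1 : K * (K * (E * C)) + A * (K * (E * C)) + B * (E * C) =
          ((1 / 4 : ℝ) • U ^ 2 + (B - (1 / 4 : ℝ) • A ^ 2)) * (E * C) := by
        rw [← mul_assoc K K, ← mul_assoc A K, ← add_mul, ← add_mul]
        congr 1
        rw [hK]
        simp only [smul_mul_assoc, mul_smul_comm, sub_mul, mul_sub, pow_two, hAV.eq]
        module
      rw [h1, hinv, mul_add, add_mul, mul_smul_comm, smul_mul_assoc, hUV2]
      exact ((hUA.pow_left 2).smul_left _).add_left
        (hBV.sub_left ((hAA.pow_left 2).smul_left _))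

theorem LEquivalent.conj {m : ℕ} {A B V W : Matrix (Fin m) (Fin m) ℝ} (h : LEquivalent A B V W)
    (S : Matrix (Fin m) (Fin m) ℝ) (hS : S.det ≠ 0) :
    LEquivalent (S * A * S⁻¹) (S * B * S⁻¹) V W := by
  obtain ⟨L, L₁, L₂, ⟨hcd, ⟨η, hη, hdet⟩, ⟨M, hM⟩⟩, h₁, h₂, hVW⟩ := h
  have hSS : S⁻¹ * S = 1 := Matrix.nonsing_inv_mul _ hS.isUnit
  refine ⟨fun t => S * L t, fun t => S * L₁ t, fun t => S * L₂ t, ⟨fun i j => ?_,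
    ⟨|S.det| * η, mul_pos (abs_pos.2 hS) hη, fun t ht => ?_⟩,
    ⟨∑ i, ∑ k, |S i k| * M, fun t ht i j => ?_⟩⟩, fun t ht i j => ?_, fun t ht i j => ?_,
    fun t ht => ?_⟩
  · simp only [Matrix.mul_apply]
    exact ContDiffOn.sum fun k _ => contDiffOn_const.mul (hcd k j)
  · rw [Matrix.det_mul, abs_mul]
    exact mul_lt_mul_of_pos_left (hdet t ht) (abs_pos.2 hS)
  · have hM0 : 0 ≤ M := (abs_nonneg _).trans (hM t ht i j)
    rw [Matrix.mul_apply]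
    calc |∑ k, S i k * L t k j| ≤ ∑ k, |S i k * L t k j| := Finset.abs_sum_le_sum_abs _ _
      _ ≤ ∑ k, |S i k| * M := Finset.sum_le_sum fun k _ => by
          rw [abs_mul]
          exact mul_le_mul_of_nonneg_left (hM t ht k j) (abs_nonneg _)
      _ ≤ ∑ i, ∑ k, |S i k| * M := Finset.single_le_sum (f := fun i => ∑ k, |S i k| * M)
          (fun i _ => Finset.sum_nonneg fun k _ => mul_nonneg (abs_nonneg _) hM0)
          (Finset.mem_univ i)
  · simp only [Matrix.mul_apply]
    exact HasDerivWithinAt.fun_sum fun k _ => (h₁ t ht k j).const_mul (S i k)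
  · simp only [Matrix.mul_apply]
    exact HasDerivWithinAt.fun_sum fun k _ => (h₂ t ht k j).const_mul (S i k)
  · have hcancel : ∀ X Y, S * X * S⁻¹ * (S * Y) = S * (X * Y) := by
      intro X Y
      calc S * X * S⁻¹ * (S * Y) = S * X * (S⁻¹ * S) * Y := by simp only [mul_assoc]
        _ = S * (X * Y) := by rw [hSS, mul_one, mul_assoc]
    have hinv : ∀ X, (S * L t)⁻¹ * (S * X) = (L t)⁻¹ * X := by
      intro X
      rw [Matrix.mul_inv_rev, mul_assoc, ← mul_assoc S⁻¹, hSS, one_mul]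
    constructor
    · rw [hcancel, ← mul_smul_comm, ← mul_add, hinv]
      exact (hVW t ht).1
    · rw [hcancel, hcancel, ← mul_add, ← mul_add, hinv]
      exact (hVW t ht).2

theorem invSqrt_mul_self {m : ℕ} {J : Matrix (Fin m) (Fin m) ℝ} (hJ : J.PosDef) :
    invSqrt J * invSqrt J = J⁻¹ := by
  have hsq : cfc Real.sqrt J * cfc Real.sqrt J = J := by
    have hnn := (Matrix.posSemidef_iff_isHermitian_and_spectrum_nonneg.1 hJ.posSemidef).2
    rw [← cfc_mul Real.sqrt Real.sqrt J Real.continuous_sqrt.continuousOn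
      Real.continuous_sqrt.continuousOn]
    conv_rhs => rw [← cfc_id ℝ J hJ.isHermitian]
    exact cfc_congr fun x hx => Real.mul_self_sqrt (hnn hx)
  rw [invSqrt, ← Matrix.mul_inv_rev, hsq]

theorem det_invSqrt_ne_zero {m : ℕ} {J : Matrix (Fin m) (Fin m) ℝ} (hJ : J.PosDef) :
    (invSqrt J).det ≠ 0 := by
  intro h
  have h1 := congrArg Matrix.det (invSqrt_mul_self hJ)
  rw [Matrix.det_mul, h, mul_zero] at h1
  exact hJ.inv.det_pos.ne h1

theorem LEquivalent.ofInertia {m : ℕ} {J K S V W : Matrix (Fin m) (Fin m) ℝ} (hJ : J.PosDef)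
    (h : LEquivalent (invSqrt J * K * invSqrt J) (invSqrt J * S * invSqrt J) V W) :
    LEquivalentOfInertia J K S V W := by
  have hdet := det_invSqrt_ne_zero hJ
  have hc : ∀ X, invSqrt J * (invSqrt J * X * invSqrt J) * (invSqrt J)⁻¹ = J⁻¹ * X := by
    intro X
    rw [← mul_assoc, Matrix.mul_nonsing_inv_cancel_right _ _ hdet.isUnit, ← mul_assoc,
      invSqrt_mul_self hJ]
  have h1 := h.conj (invSqrt J) hdet
  rwa [hc, hc] at h1

theorem mainTheorem12 {m : ℕ} (J D G P Pi : Matrix (Fin m) (Fin m) ℝ)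
    (hJ : J.PosDef) (hD : D.IsSymm) (hG : Gᵀ = -G) (hP : Pᵀ = -P) (hPi : Pi.IsSymm)
    (A B : Matrix (Fin m) (Fin m) ℝ)
    (hA : A = invSqrt J * (D + G) * invSqrt J)
    (hB : B = invSqrt J * (P + Pi) * invSqrt J)
    (V C : Matrix (Fin m) (Fin m) ℝ) (hC : C.det ≠ 0)
    (hAV : ⁅A, C * V * C⁻¹⁆ = 0)
    (hBV : ⁅B, A - C * V * C⁻¹⁆ = 0)
    (hR : C.map Complex.ofReal * jordanRealPart V = jordanRealPart A * C.map Complex.ofReal)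
    (W : Matrix (Fin m) (Fin m) ℝ)
    (hW : W = (1 / 4 : ℝ) • V ^ 2 + C⁻¹ * (B - (1 / 4 : ℝ) • A ^ 2) * C) :
    (V.IsSymm →
      LEquivalent A B V W ∧ LEquivalentOfInertia J (D + G) (P + Pi) V W) ∧
    (V ^ 2 - (V ^ 2)ᵀ + C⁻¹ * ((4 : ℝ) • B - A ^ 2) * C
        - Cᵀ * ((4 : ℝ) • B - A ^ 2)ᵀ * (C⁻¹)ᵀ = 0 →
      LEquivalent A B V W ∧ LEquivalentOfInertia J (D + G) (P + Pi) V W ∧ W.IsSymm) ∧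
    (V.IsSymm →
      C⁻¹ * (B - (1 / 4 : ℝ) • A ^ 2) * C
        - Cᵀ * (B - (1 / 4 : ℝ) • A ^ 2)ᵀ * (C⁻¹)ᵀ = 0 →
      LEquivalent A B V W ∧ LEquivalentOfInertia J (D + G) (P + Pi) V W ∧ W.IsSymm) := by
  have hL : LEquivalent A B V W := by
    rw [hW]
    exact lEquivalent_of_commute A B V C hC (commute_iff_lie_eq.2 hAV) (commute_iff_lie_eq.2 hBV) hR
  have hJL : LEquivalentOfInertia J (D + G) (P + Pi) V W :=
    LEquivalent.ofInertia hJ (hA ▸ hB ▸ hL)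
  refine ⟨fun _ => ⟨hL, hJL⟩, fun h => ⟨hL, hJL, ?_⟩, fun hV h => ⟨hL, hJL, ?_⟩⟩
  · have h4 : (4 : ℝ) • W = V ^ 2 + C⁻¹ * ((4 : ℝ) • B - A ^ 2) * C := by
      have h5 : (4 : ℝ) • B - A ^ 2 = (4 : ℝ) • (B - (1 / 4 : ℝ) • A ^ 2) := by module
      rw [hW, h5, mul_smul_comm, smul_mul_assoc]
      module
    have h6 : ((4 : ℝ) • W)ᵀ = (4 : ℝ) • W := by
      rw [h4]
      simp only [Matrix.transpose_add, Matrix.transpose_mul (C⁻¹ * _) C,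
        Matrix.transpose_mul C⁻¹, ← mul_assoc]
      rw [← sub_eq_zero, ← neg_eq_zero, ← h]
      abel
    rw [Matrix.transpose_smul] at h6
    exact smul_right_injective _ (four_ne_zero (α := ℝ)) h6
  · have hV2 : (V ^ 2)ᵀ = V ^ 2 := by rw [Matrix.transpose_pow, hV.eq]
    rw [Matrix.IsSymm, hW]
    simp only [Matrix.transpose_add, Matrix.transpose_smul (1 / 4 : ℝ) (V ^ 2), hV2,
      Matrix.transpose_mul (C⁻¹ * _) C, Matrix.transpose_mul C⁻¹, ← mul_assoc]
    rw [sub_eq_zero.1 h]
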